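/- **Setting.** Let $\mathbb F$ be a field. For $d\ge 1$ let $M^{(i)}=(x^{(i)}_{j,k})_{j,k\in\{1,2\}}$, $1\le i\le d$, be $2\times2$ matrices whose $4d$ entries are distinct variables, let $M=M^{(1)}M^{(2)}\cdots M^{(d)}$, and let $\mathrm{IMM}_d=M_{1,1}+M_{1,2}\in\mathbb F[X]$, where $X$ is the set of all these variables. An (algebraic) formula over $\mathbb F$ and $X$ is a finite tree with gates of unbounded fan-in. Its input gates are labelled by variables of $X$ or elements of $\mathbb F$; every other gate is a sum gate, which computes an $\mathbb F$-linear combination of its children (the coefficients label the edges), or a product gate, which computes the product of its children. The size of a formula is its number of gates, input gates included. A formula is *syntactic multilinear* if, for each of its product gates, any two distinct children have disjoint sets of variables appearing in their subformulas. For $\Delta\ge1$ it is a $(\Sigma\Pi)^\Delta\Sigma$ *formula* if its output gate is a sum gate, sum and product gates alternate along every path from the output gate to an input gate, every such path contains exactly $\Delta$ product gates, and all input gates feed into sum gates. **Theorem.** There is an absolute constant $c>0$ such that for every field $\mathbb F$ and all integers $d\ge1$ and $\Delta\ge1$ with $\Delta\le\log_2 d$, every syntactic multilinear $(\Sigma\Pi)^\Delta\Sigma$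 formula over $\mathbb F$ that computes $\mathrm{IMM}_d$ has size at least $$2^{\,c\,\Delta\, d^{1/\Delta}} .$$ -/

import Mathlib

open scoped BigOperators

/-- Algebraic formulas over the field `F` in the variables `X`, as trees with gates of unbounded
fan-in. Input gates carry a variable or a field constant. A sum gate with children `f i` and
edge weights `w i` computes `∑ i, w i * f i` (weights `1` give plain sums); a product gate
computes the product of its children. -/
inductive AlgFormula (F : Type*) (X : Type*) where
  | var (x : X) : AlgFormula F X
  | const (a : F) : AlgFormula F X
  | sum (n : ℕ) (w : Fin n → F) (f : Fin n → AlgFormula F X) : AlgFormula F X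
  | prod (n : ℕ) (f : Fin n → AlgFormula F X) : AlgFormula F X

namespace AlgFormula

/-- The polynomial computed by a formula. -/
noncomputable def eval {F X : Type*} [Field F] : AlgFormula F X → MvPolynomial X F
  | var x => MvPolynomial.X x
  | const a => MvPolynomial.C a
  | sum _ w f => ∑ i, MvPolynomial.C (w i) * (f i).eval
  | prod _ f => ∏ i, (f i).eval

/-- The size of a formula: the number of its gates, input gates included. -/
def size {F X : Type*} : AlgFormula F X → ℕ
  | var _ => 1
  | const _ => 1
  | sum _ _ f => 1 + ∑ i, (f i).size
  | prod _ f => 1 + ∑ i, (f i).size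

/-- The set of variables that appear (syntactically) in a formula. -/
def supp {F X : Type*} : AlgFormula F X → Set X
  | var x => {x}
  | const _ => ∅
  | sum _ _ f => ⋃ i, (f i).supp
  | prod _ f => ⋃ i, (f i).supp

/-- Syntactic multilinearity: at every product gate of the formula, the children have pairwise
disjoint supports. -/
def SyntacticMultilinear {F X : Type*} : AlgFormula F X → Prop
  | var _ => True
  | const _ => True
  | sum _ _ f => ∀ i, (f i).SyntacticMultilinear
  | prod _ f => (∀ i, (f i).SyntacticMultilinear) ∧
      Pairwise fun i j => Disjoint (f i).supp (f j).supp

/-- Input gates. -/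
def IsInput {F X : Type*} : AlgFormula F X → Prop
  | var _ => True
  | const _ => True
  | sum _ _ _ => False
  | prod _ _ => False

/-- `(ΣΠ)^Δ Σ` formulas: the output gate is a sum gate, sum and product gates alternate along
every path, every path from an input gate to the output passes through exactly `Δ` product gates,
and input gates feed into sum gates only. -/
def IsSigmaPiSigma {F X : Type*} : ℕ → AlgFormula F X → Prop
  | 0, sum _ _ f => ∀ i, (f i).IsInput
  | Δ + 1, sum _ _ f => ∀ i, ∃ (k : ℕ) (g : Fin k → AlgFormula F X),
      f i = prod k g ∧ ∀ j, IsSigmaPiSigma Δ (g j)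
  | _, _ => False

end AlgFormula

/-- The variables of `IMM_d`: the triple `(i, j, k)` is the `(j, k)` entry of the `i`-th matrix. -/
abbrev IMMVar (d : ℕ) : Type := Fin d × Fin 2 × Fin 2

/-- The `i`-th generic `2 × 2` matrix. -/
noncomputable def genericMatrix (F : Type*) [Field F] (d : ℕ) (i : Fin d) :
    Matrix (Fin 2) (Fin 2) (MvPolynomial (IMMVar d) F) :=
  Matrix.of fun j k => MvPolynomial.X (i, j, k)

/-- `IMM_d`: the sum of the two entries in the first row of the ordered product of the `d` generic
`2 × 2` matrices. -/
noncomputable def IMM (F : Type*) [Field F] (d : ℕ) : MvPolynomial (IMMVar d) F :=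
  (List.ofFn (genericMatrix F d)).prod 0 0 + (List.ofFn (genericMatrix F d)).prod 0 1

/-! Switch on a random subset `S` of the `d` top-left entries `A`, and compare ranks of evaluation
matrices on `S`, under the worst split into row and column variables, with `2 ^ (|S| / 2)` for the
real quotient. The rank never exceeds `2 ^ ⌊|S| / 2⌋`, so odd `S` lose a factor `√2`; hence the mean
relative rank is at most `(1 + 1/√2) / 2 < 1` on any nonempty set of variables
(`meanRelRank_le_of_nonempty`). It is subadditive over sums, and submultiplicative over multilinear
products, since `S` splits into independent parts (`meanRelRank_prod_le`).

For `IMM` every `S` attains `2 ^ ⌊|S| / 2⌋` (`two_pow_le_worstRank_IMM`), so the mean is at least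
`1/2`. In a formula, a product gate whose children share the current variables among `m + 1` of them
gains `m` constant factors from all but the child with the largest share, and the argument descends
into that child (`hasDecay_prod`). A bottom product of linear forms gains a factor per variable.
Shares shrink by at most `m i + 1` per level, so `∏ (m i + 1) ≥ d`; AM-GM makes `∑ m i` of order `Δ
d ^ (1 / Δ)`, and the size must offset that decay. -/

/-! ### Matrices as sums of rank-one matrices -/

/-- `N` is a sum of `m` matrices of rank at most one. -/
def FactorRankLE {F R C : Type*} [Field F] (N : R → C → F) (m : ℕ) : Prop :=
  ∃ (f : R → Fin m → F) (g : Fin m → C → F), ∀ r c, N r c = ∑ k, f r k * g k c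

namespace FactorRankLE

variable {F R C : Type*} [Field F]

theorem of_fintype {ι : Type*} [Fintype ι] {N : R → C → F} (f : R → ι → F) (g : ι → C → F)
    (h : ∀ r c, N r c = ∑ k, f r k * g k c) : FactorRankLE N (Fintype.card ι) := by
  refine ⟨fun r k => f r ((Fintype.equivFin ι).symm k),
    fun k c => g ((Fintype.equivFin ι).symm k) c, fun r c => ?_⟩
  rw [h, ← Equiv.sum_comp (Fintype.equivFin ι).symm]

theorem mono {N : R → C → F} {m n : ℕ} (h : FactorRankLE N m) (hmn : m ≤ n) :
    FactorRankLE N n := by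
  obtain ⟨f, g, h⟩ := h
  obtain ⟨l, rfl⟩ := Nat.exists_eq_add_of_le hmn
  refine ⟨fun r => Fin.append (f r) 0, fun k c => Fin.append (fun i => g i c) 0 k,
    fun r c => ?_⟩
  simp [h, Fin.sum_univ_add]

theorem zero : FactorRankLE (fun (_ : R) (_ : C) => (0 : F)) 0 :=
  ⟨fun _ => Fin.elim0, fun k => k.elim0, fun _ _ => by simp⟩

theorem add {N N' : R → C → F} {m n : ℕ} (h : FactorRankLE N m) (h' : FactorRankLE N' n) :
    FactorRankLE (fun r c => N r c + N' r c) (m + n) := by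
  obtain ⟨f, g, h⟩ := h
  obtain ⟨f', g', h'⟩ := h'
  refine ⟨fun r => Fin.append (f r) (f' r),
    fun k c => Fin.append (fun i => g i c) (fun i => g' i c) k, fun r c => ?_⟩
  simp [h, h', Fin.sum_univ_add]

theorem smul {N : R → C → F} {m : ℕ} (h : FactorRankLE N m) (w : F) :
    FactorRankLE (fun r c => w * N r c) m := by
  obtain ⟨f, g, h⟩ := h
  exact ⟨fun r k => w * f r k, g, fun r c => by simp [h, Finset.mul_sum, mul_assoc]⟩

theorem one : FactorRankLE (fun (_ : R) (_ : C) => (1 : F)) 1 :=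
  ⟨fun _ _ => 1, fun _ _ => 1, fun _ _ => by simp⟩

/-- The rank of an entrywise product is at most the product of the ranks. -/
theorem mul {N N' : R → C → F} {m n : ℕ} (h : FactorRankLE N m) (h' : FactorRankLE N' n) :
    FactorRankLE (fun r c => N r c * N' r c) (m * n) := by
  obtain ⟨f, g, h⟩ := h
  obtain ⟨f', g', h'⟩ := h'
  have := of_fintype (ι := Fin m × Fin n) (N := fun r c => N r c * N' r c)
    (fun r k => f r k.1 * f' r k.2) (fun k c => g k.1 c * g' k.2 c) (fun r c => by
      simp only [h, h', Finset.sum_mul_sum, Fintype.sum_prod_type]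
      exact Finset.sum_congr rfl fun i _ => Finset.sum_congr rfl fun j _ => by ring)
  simpa using this

theorem sum {ι : Type*} (s : Finset ι) {N : ι → R → C → F} {m : ι → ℕ}
    (h : ∀ i ∈ s, FactorRankLE (N i) (m i)) :
    FactorRankLE (fun r c => ∑ i ∈ s, N i r c) (∑ i ∈ s, m i) := by
  classical
  induction s using Finset.induction_on with
  | empty => simpa using zero
  | insert a s ha ih =>
    simp only [Finset.sum_insert ha]
    exact (h a (by simp)).add (ih fun i hi => h i (by simp [hi]))

theorem prod {ι : Type*} (s : Finset ι) {N : ι → R → C → F} {m : ι → ℕ}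
    (h : ∀ i ∈ s, FactorRankLE (N i) (m i)) :
    FactorRankLE (fun r c => ∏ i ∈ s, N i r c) (∏ i ∈ s, m i) := by
  classical
  induction s using Finset.induction_on with
  | empty => simpa using one
  | insert a s ha ih =>
    simp only [Finset.prod_insert ha]
    exact (h a (by simp)).mul (ih fun i hi => h i (by simp [hi]))

theorem add_separated (u : R → F) (v : C → F) : FactorRankLE (fun r c => u r + v c) 2 :=
  ⟨fun r => ![u r, 1], fun k c => ![1, v c] k, fun r c => by simp⟩

/-- A matrix whose rows are determined by an index in `ι` has rank at most the size of `ι`. -/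
theorem of_rows {ι : Type*} [Fintype ι] (π : R → ι) (N : ι → C → F) :
    FactorRankLE (fun r c => N (π r) c) (Fintype.card ι) := by
  classical
  exact of_fintype (fun r k => if π r = k then 1 else 0) N fun r c => by simp

theorem of_columns {ι : Type*} [Fintype ι] (π : C → ι) (N : R → ι → F) :
    FactorRankLE (fun r c => N r (π c)) (Fintype.card ι) := by
  classical
  exact of_fintype N (fun k c => if π c = k then 1 else 0) fun r c => by simp

theorem comp {R' C' : Type*} {N : R → C → F} {m : ℕ} (h : FactorRankLE N m) (a : R' → R)
    (b : C' → C) : FactorRankLE (fun r c => N (a r) (b c)) m := by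
  obtain ⟨f, g, h⟩ := h
  exact ⟨fun r => f (a r), fun k c => g k (b c), fun r c => h _ _⟩

theorem card_le {ι : Type*} [Fintype ι] [DecidableEq ι] {N K : Matrix ι ι F} {m : ℕ}
    (h : FactorRankLE N m) (hK : N * K = 1) : Fintype.card ι ≤ m := by
  obtain ⟨f, g, h⟩ := h
  have hN : N = (Matrix.of f) * (Matrix.of g) := by
    ext r c
    simp [Matrix.mul_apply, h]
  have h1 : (1 : Matrix ι ι F).rank ≤ m := by
    rw [← hK, hN, Matrix.mul_assoc]
    refine (Matrix.rank_mul_le_left _ _).trans ?_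
    simpa using Matrix.rank_le_card_width (Matrix.of f)
  simpa using h1

end FactorRankLE

/-! ### Evaluation matrices under the worst partition -/

/-- The value in `F` of a bit. -/
def bitValue (F : Type*) [Field F] (b : Bool) : F := if b then 1 else 0

open Classical in
/-- The point whose coordinates in `S` are bits, taken from `r` on `Y` and from `c` off `Y`, and
whose other coordinates are those of `base`. -/
noncomputable def splitPoint {F X : Type*} [Field F] (Y S : Finset X) (base : X → F)
    (r c : X → Bool) (x : X) : F :=
  if x ∈ S then (if x ∈ Y then bitValue F (r x) else bitValue F (c x)) else base x

/-- The largest rank of the evaluation matrix of `f`, over all partitions of the variables in `S`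
into row and column variables and all values of the other variables. -/
noncomputable def worstRank {F X : Type*} [Field F] (f : (X → F) → F) (S : Finset X) : ℕ :=
  sInf {m | ∀ (Y : Finset X) (base : X → F),
    FactorRankLE (fun r c => f (splitPoint Y S base r c)) m}

section worstRank

variable {F X : Type*} [Field F]

theorem worstRank_le {f : (X → F) → F} {S : Finset X} {m : ℕ}
    (h : ∀ (Y : Finset X) (base : X → F),
      FactorRankLE (fun r c => f (splitPoint Y S base r c)) m) : worstRank f S ≤ m :=
  Nat.sInf_le h

/-- The smaller side of the partition has at most `⌊|S| / 2⌋` variables, which bounds the number of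
distinct rows or columns. The rounding down is the source of every gain below. -/
theorem factorRankLE_two_pow (f : (X → F) → F) (S Y : Finset X) (base : X → F) :
    FactorRankLE (fun r c => f (splitPoint Y S base r c)) (2 ^ (S.card / 2)) := by
  classical
  have hcard : (S.filter (· ∈ Y)).card + (S.filter (· ∉ Y)).card = S.card :=
    Finset.card_filter_add_card_filter_not _
  rcases le_total (S.filter (· ∈ Y)).card (S.filter (· ∉ Y)).card with hle | hle
  · have h := FactorRankLE.of_rows (F := F) (C := X → Bool)
      (fun (r : X → Bool) (x : (S.filter (· ∈ Y) : Finset X)) => r x)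
      (fun σ c => f (splitPoint Y S base
        (fun x => if h : x ∈ S.filter (· ∈ Y) then σ ⟨x, h⟩ else false) c))
    simp only [Fintype.card_fun, Fintype.card_bool, Fintype.card_coe] at h
    refine FactorRankLE.mono ?_ (Nat.pow_le_pow_right (by norm_num)
      (show (S.filter (· ∈ Y)).card ≤ S.card / 2 by omega))
    convert h using 4 with r c
    funext x
    unfold splitPoint
    by_cases h1 : x ∈ S <;> by_cases h2 : x ∈ Y <;> simp [h1, h2]
  · have h := FactorRankLE.of_columns (F := F) (R := X → Bool)
      (fun (c : X → Bool) (x : (S.filter (· ∉ Y) : Finset X)) => c x)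
      (fun r σ => f (splitPoint Y S base r
        (fun x => if h : x ∈ S.filter (· ∉ Y) then σ ⟨x, h⟩ else false)))
    simp only [Fintype.card_fun, Fintype.card_bool, Fintype.card_coe] at h
    refine FactorRankLE.mono ?_ (Nat.pow_le_pow_right (by norm_num)
      (show (S.filter (· ∉ Y)).card ≤ S.card / 2 by omega))
    convert h using 4 with r c
    funext x
    unfold splitPoint
    by_cases h1 : x ∈ S <;> by_cases h2 : x ∈ Y <;> simp [h1, h2]

theorem worstRank_le_two_pow (f : (X → F) → F) (S : Finset X) :
    worstRank f S ≤ 2 ^ (S.card / 2) :=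
  worstRank_le fun Y base => factorRankLE_two_pow f S Y base

theorem worstRank_spec (f : (X → F) → F) (S Y : Finset X) (base : X → F) :
    FactorRankLE (fun r c => f (splitPoint Y S base r c)) (worstRank f S) :=
  (Nat.sInf_mem (s := {m | ∀ (Y : Finset X) (base : X → F),
    FactorRankLE (fun r c => f (splitPoint Y S base r c)) m})
    ⟨_, fun Y base => factorRankLE_two_pow f S Y base⟩) Y base

theorem worstRank_sum_le {ι : Type*} (s : Finset ι) (w : ι → F) (f : ι → (X → F) → F)
    (S : Finset X) :
    worstRank (fun p => ∑ i ∈ s, w i * f i p) S ≤ ∑ i ∈ s, worstRank (f i) S :=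
  worstRank_le fun Y base =>
    FactorRankLE.sum s fun i _ => (worstRank_spec (f i) S Y base).smul (w i)

theorem worstRank_prod_le {ι : Type*} (s : Finset ι) (f : ι → (X → F) → F) (S : Finset X) :
    worstRank (fun p => ∏ i ∈ s, f i p) S ≤ ∏ i ∈ s, worstRank (f i) S :=
  worstRank_le fun Y base => FactorRankLE.prod s fun i _ => worstRank_spec (f i) S Y base

/-- Only the variables on which `f` depends matter for its worst rank. -/
theorem worstRank_le_of_dependsOn {f : (X → F) → F} {W : Set X}
    (hf : ∀ p q : X → F, (∀ x ∈ W, p x = q x) → f p = f q) {S T : Finset X}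
    (hST : ∀ x ∈ W, x ∈ S ↔ x ∈ T) : worstRank f S ≤ worstRank f T := by
  refine worstRank_le fun Y base => ?_
  convert worstRank_spec f T Y base using 3 with r c
  refine hf _ _ fun x hx => ?_
  have h := hST x hx
  by_cases hT : x ∈ T
  · simp [splitPoint, hT, h.2 hT]
  · simp [splitPoint, hT, mt h.1 hT]

end worstRank

/-! ### Mean relative rank over random sets of variables -/

/-- The average over the subsets `S` of `A` of the worst rank of `f` relative to `2 ^ (|S| / 2)`. -/
noncomputable def meanRelRank {F X : Type*} [Field F] (A : Finset X) (f : (X → F) → F) : ℝ :=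
  (∑ S ∈ A.powerset, (worstRank f S : ℝ) * (√2)⁻¹ ^ S.card) / 2 ^ A.card

section meanRelRank

variable {F X : Type*} [Field F]

theorem meanRelRank_nonneg (A : Finset X) (f : (X → F) → F) : 0 ≤ meanRelRank A f := by
  unfold meanRelRank
  positivity

theorem meanRelRank_sum_le {ι : Type*} (s : Finset ι) (w : ι → F) (f : ι → (X → F) → F)
    (A : Finset X) :
    meanRelRank A (fun p => ∑ i ∈ s, w i * f i p) ≤ ∑ i ∈ s, meanRelRank A (f i) := by
  unfold meanRelRank
  rw [← Finset.sum_div, Finset.sum_comm]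
  gcongr with S
  rw [← Finset.sum_mul]
  gcongr
  exact_mod_cast worstRank_sum_le s w f S

/-- Independence: choosing a subset of `A` amounts to choosing a subset of each fibre of `κ`
separately. -/
theorem sum_powerset_prod_filter {ι : Type*} [Fintype ι] [DecidableEq ι] (A : Finset X)
    (κ : X → ι) (h : ι → Finset X → ℝ) :
    ∑ S ∈ A.powerset, ∏ j, h j (S.filter (κ · = j)) =
      ∏ j, ∑ T ∈ (A.filter (κ · = j)).powerset, h j T := by
  classical
  rw [Finset.prod_univ_sum]
  refine Finset.sum_nbij' (fun S j => S.filter (κ · = j)) (fun φ => Finset.univ.biUnion φ)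
    ?_ ?_ ?_ ?_ ?_
  · intro S hS
    simp only [Fintype.mem_piFinset, Finset.mem_powerset] at hS ⊢
    exact fun j => Finset.filter_subset_filter _ hS
  · intro φ hφ
    simp only [Fintype.mem_piFinset, Finset.mem_powerset] at hφ ⊢
    exact Finset.biUnion_subset.2 fun j _ => (hφ j).trans (Finset.filter_subset _ _)
  · intro S _
    ext x
    simp
  · intro φ hφ
    simp only [Fintype.mem_piFinset, Finset.mem_powerset] at hφ
    funext j
    ext x
    simp only [Finset.mem_filter, Finset.mem_biUnion, Finset.mem_univ, true_and]
    constructor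
    · rintro ⟨⟨i, hi⟩, rfl⟩
      rwa [(Finset.mem_filter.1 (hφ i hi)).2]
    · exact fun hx => ⟨⟨j, hx⟩, (Finset.mem_filter.1 (hφ j hx)).2⟩
  · intro S _
    rfl

theorem meanRelRank_prod_le {ι : Type*} [Fintype ι] [DecidableEq ι] (A : Finset X) (κ : X → ι)
    (f : ι → (X → F) → F) (W : ι → Set X)
    (hf : ∀ j (p q : X → F), (∀ x ∈ W j, p x = q x) → f j p = f j q)
    (hκ : ∀ j, ∀ x ∈ W j, κ x = j) :
    meanRelRank A (fun p => ∏ j, f j p) ≤ ∏ j, meanRelRank (A.filter (κ · = j)) (f j) := by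
  classical
  have hcard (S : Finset X) : S.card = ∑ j, (S.filter (κ · = j)).card :=
    Finset.card_eq_sum_card_fiberwise fun x _ => Finset.mem_coe.2 (Finset.mem_univ (κ x))
  unfold meanRelRank
  rw [Finset.prod_div_distrib, Finset.prod_pow_eq_pow_sum, ← hcard,
    ← sum_powerset_prod_filter A κ fun j T => (worstRank (f j) T : ℝ) * (√2)⁻¹ ^ T.card]
  gcongr with S
  rw [Finset.prod_mul_distrib, Finset.prod_pow_eq_pow_sum, ← hcard]
  gcongr
  have h1 := worstRank_prod_le Finset.univ f S
  have h2 : ∏ j, worstRank (f j) S ≤ ∏ j, worstRank (f j) (S.filter (κ · = j)) :=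
    Finset.prod_le_prod' fun j _ => worstRank_le_of_dependsOn (hf j) fun x hx => by
      simp [hκ j x hx]
  exact_mod_cast h1.trans h2

theorem inv_sqrt_two_le : (1 + (√2)⁻¹) / 2 ≤ 6 / 7 := by
  have h : (7 / 5 : ℝ) ≤ √2 := Real.le_sqrt_of_sq_le (by norm_num)
  have : (√2)⁻¹ ≤ (7 / 5 : ℝ)⁻¹ := inv_anti₀ (by norm_num) h
  norm_num at this
  linarith

theorem meanRelRank_le_of_worstRank_le {A : Finset X} {f : (X → F) → F} {m : ℕ}
    (h : ∀ S, worstRank f S ≤ m) : meanRelRank A f ≤ m * (6 / 7) ^ A.card := by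
  have h1 : ∑ S ∈ A.powerset, (√2)⁻¹ ^ S.card = ((√2)⁻¹ + 1) ^ A.card := by
    simpa using Finset.sum_pow_mul_eq_add_pow (√2)⁻¹ 1 A
  have h2 : meanRelRank A f ≤ m * (((√2)⁻¹ + 1) / 2) ^ A.card := by
    unfold meanRelRank
    rw [div_pow, ← h1, ← mul_div_assoc, Finset.mul_sum]
    gcongr with S
    exact h S
  refine h2.trans ?_
  rw [add_comm]
  exact mul_le_mul_of_nonneg_left
    (pow_le_pow_left₀ (by positivity) inv_sqrt_two_le _) (Nat.cast_nonneg m)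

/-- Both sides are `1` for even `n` and `1/√2` for odd `n`; the sign form makes the parity term
cancel when summed over a powerset. -/
theorem two_pow_half_mul (n : ℕ) :
    (2 : ℝ) ^ (n / 2) * (√2)⁻¹ ^ n = (1 + (√2)⁻¹) / 2 + (-1) ^ n * ((1 - (√2)⁻¹) / 2) := by
  have hsq : (√2)⁻¹ ^ 2 = (2 : ℝ)⁻¹ := by
    rw [inv_pow, Real.sq_sqrt (by norm_num)]
  rcases Nat.even_or_odd' n with ⟨k, rfl | rfl⟩
  · rw [pow_mul (√2)⁻¹, hsq, Nat.mul_div_cancel_left k (by norm_num), ← mul_pow, pow_mul]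
    norm_num
    ring
  · rw [pow_succ (√2)⁻¹, pow_mul (√2)⁻¹, hsq, show (2 * k + 1) / 2 = k by omega, ← mul_assoc,
      ← mul_pow, pow_succ, pow_mul]
    norm_num
    ring

theorem meanRelRank_le_of_nonempty {A : Finset X} (hA : A.Nonempty) (f : (X → F) → F) :
    meanRelRank A f ≤ 6 / 7 := by
  classical
  refine le_trans ?_ inv_sqrt_two_le
  unfold meanRelRank
  rw [div_le_iff₀ (by positivity)]
  calc ∑ S ∈ A.powerset, (worstRank f S : ℝ) * (√2)⁻¹ ^ S.card
      ≤ ∑ S ∈ A.powerset, ((1 + (√2)⁻¹) / 2 + (-1) ^ S.card * ((1 - (√2)⁻¹) / 2)) := by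
        refine Finset.sum_le_sum fun S _ => ?_
        rw [← two_pow_half_mul]
        gcongr
        exact_mod_cast worstRank_le_two_pow f S
    _ = (1 + (√2)⁻¹) / 2 * 2 ^ A.card := by
        have h : ∑ S ∈ A.powerset, (-1 : ℝ) ^ S.card = 0 := by
          exact_mod_cast Finset.sum_powerset_neg_one_pow_card_of_nonempty hA
        rw [Finset.sum_add_distrib, ← Finset.sum_mul, h]
        simp [mul_comm]

theorem meanRelRank_le_one (A : Finset X) (f : (X → F) → F) : meanRelRank A f ≤ 1 := by
  rcases A.eq_empty_or_nonempty with rfl | hA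
  · simpa [meanRelRank] using worstRank_le_two_pow f ∅
  · exact (meanRelRank_le_of_nonempty hA f).trans (by norm_num)

theorem le_meanRelRank {A : Finset X} {f : (X → F) → F}
    (h : ∀ S ⊆ A, 2 ^ (S.card / 2) ≤ worstRank f S) : 1 / 2 ≤ meanRelRank A f := by
  have hs : (√2)⁻¹ ≤ 1 := inv_le_one_of_one_le₀ (Real.one_le_sqrt.2 (by norm_num))
  have hs2 : (1 / 2 : ℝ) ≤ (√2)⁻¹ := by
    rw [one_div]
    exact inv_anti₀ (by positivity) (Real.sqrt_le_iff.2 (by norm_num))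
  unfold meanRelRank
  rw [le_div_iff₀ (by positivity)]
  calc (1 / 2 : ℝ) * 2 ^ A.card = ∑ S ∈ A.powerset, (1 / 2 : ℝ) := by simp [mul_comm]
    _ ≤ _ := by
      refine Finset.sum_le_sum fun S hS => ?_
      have h1 : (1 / 2 : ℝ) ≤ (2 : ℝ) ^ (S.card / 2) * (√2)⁻¹ ^ S.card := by
        rw [two_pow_half_mul]
        rcases neg_one_pow_eq_or ℝ S.card with h | h <;> rw [h] <;> linarith
      refine h1.trans ?_
      gcongr
      exact_mod_cast h S (Finset.mem_powerset.1 hS)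

/-- Two regimes: the parity bound `6/7` for few variables, the bound `2 * (6/7) ^ |A|` for many. The
constant `39/40` serves both. -/
theorem meanRelRank_le_of_worstRank_le_two {A : Finset X} {f : (X → F) → F}
    (h : ∀ S, worstRank f S ≤ 2) : meanRelRank A f ≤ (39 / 40) ^ A.card := by
  rcases A.eq_empty_or_nonempty with rfl | hA
  · simpa using meanRelRank_le_one ∅ f
  -- The threshold works because `6/7 ≤ (39/40) ^ 6` and, as `6/7 = (80/91) * (39/40)`, because `2 *
  -- (80/91) ^ 6 ≤ 1`.
  rcases le_total A.card 6 with h6 | h6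
  · refine (meanRelRank_le_of_nonempty hA f).trans (le_trans ?_
      (pow_le_pow_of_le_one (by norm_num) (by norm_num) h6))
    norm_num
  · refine (meanRelRank_le_of_worstRank_le h).trans ?_
    have h1 : (80 / 91 : ℝ) ^ A.card ≤ (80 / 91) ^ 6 :=
      pow_le_pow_of_le_one (by norm_num) (by norm_num) h6
    have h2 : (6 / 7 : ℝ) ^ A.card = (80 / 91) ^ A.card * (39 / 40) ^ A.card := by
      rw [← mul_pow]
      norm_num
    rw [h2, ← mul_assoc]
    refine mul_le_of_le_one_left (by positivity) ?_
    norm_num at h1 ⊢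
    linarith

end meanRelRank

/-! ### Decay of the mean relative rank in formulas -/

namespace AlgFormula

theorem one_le_size {F X : Type*} (Φ : AlgFormula F X) : 1 ≤ Φ.size := by
  cases Φ <;> simp [size]

theorem size_le_size_prod {F X : Type*} {n : ℕ} (f : Fin n → AlgFormula F X) (j : Fin n) :
    (f j).size ≤ (prod n f).size := by
  have := Finset.single_le_sum (f := fun i => (f i).size) (fun _ _ => Nat.zero_le _)
    (Finset.mem_univ j)
  simp only [size]
  omega

variable {F X : Type*} [Field F]

/-- The value of a formula at a point. -/
noncomputable def value (Φ : AlgFormula F X) (p : X → F) : F := MvPolynomial.eval p Φ.eval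

@[simp] theorem value_sum (n : ℕ) (w : Fin n → F) (f : Fin n → AlgFormula F X) :
    (sum n w f).value = fun p => ∑ i, w i * (f i).value p := by
  funext p
  simp [value, eval]

@[simp] theorem value_prod (n : ℕ) (f : Fin n → AlgFormula F X) :
    (prod n f).value = fun p => ∏ i, (f i).value p := by
  funext p
  simp [value, eval, map_prod]

theorem value_congr (Φ : AlgFormula F X) (p q : X → F) (h : ∀ x ∈ Φ.supp, p x = q x) :
    Φ.value p = Φ.value q := by
  induction Φ with
  | var x => simpa [value, eval] using h x (by simp [supp])
  | const a => simp [value, eval]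
  | sum n w f ih =>
    simp only [value_sum]
    exact Finset.sum_congr rfl fun i _ => by
      rw [ih i fun x hx => h x (Set.mem_iUnion.2 ⟨i, hx⟩)]
  | prod n f ih =>
    simp only [value_prod]
    exact Finset.prod_congr rfl fun i _ => ih i fun x hx => h x (Set.mem_iUnion.2 ⟨i, hx⟩)

/-- A single variable lies on only one side of the partition. The separated form survives linear
combinations, whence rank at most `2`. -/
theorem IsInput.exists_value_splitPoint {Φ : AlgFormula F X} (hΦ : Φ.IsInput) (Y S : Finset X)
    (base : X → F) : ∃ u v : (X → Bool) → F,
      ∀ r c, Φ.value (splitPoint Y S base r c) = u r + v c := by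
  classical
  cases Φ with
  | var x =>
    refine ⟨fun r => if x ∈ S ∧ x ∈ Y then bitValue F (r x) else 0, fun c => if x ∈ S then
      (if x ∈ Y then 0 else bitValue F (c x)) else base x, fun r c => ?_⟩
    by_cases h1 : x ∈ S <;> by_cases h2 : x ∈ Y <;> simp [value, eval, splitPoint, h1, h2]
  | const a => exact ⟨fun _ => a, fun _ => 0, fun r c => by simp [value, eval]⟩
  | sum => exact hΦ.elim
  | prod => exact hΦ.elim

theorem IsSigmaPiSigma.worstRank_le_two {Φ : AlgFormula F X} (hΦ : Φ.IsSigmaPiSigma 0)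
    (S : Finset X) : worstRank Φ.value S ≤ 2 := by
  cases Φ with
  | sum n w f =>
    refine worstRank_le fun Y base => ?_
    choose u v huv using fun i => (hΦ i).exists_value_splitPoint Y S base
    convert FactorRankLE.add_separated (fun r => ∑ i, w i * u i r) (fun c => ∑ i, w i * v i c)
      using 3 with r c
    simp [huv, mul_add, Finset.sum_add_distrib]
  | var => exact hΦ.elim
  | const => exact hΦ.elim
  | prod => exact hΦ.elim

/-- The bound on the mean relative rank in which the depth enters: some `n` numbers `m i + 1` have
product at least `|A|`, and each `m i` gains a factor `(39 / 40) ^ m i` over the size. -/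
def HasDecay (n : ℕ) (Φ : AlgFormula F X) (A : Finset X) : Prop :=
  ∃ m : Fin n → ℕ, A.card ≤ ∏ i, (m i + 1) ∧
    meanRelRank A Φ.value ≤ Φ.size * (39 / 40) ^ ∑ i, m i

theorem hasDecay_of_le_pow {n : ℕ} {Φ : AlgFormula F X} {A : Finset X}
    (h : meanRelRank A Φ.value ≤ (39 / 40) ^ A.card) : HasDecay (n + 1) Φ A := by
  refine ⟨Fin.cons A.card fun _ => 0, by simp [Fin.prod_univ_succ], ?_⟩
  have hs : (1 : ℝ) ≤ Φ.size := by exact_mod_cast Φ.one_le_size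
  simp only [Fin.sum_univ_succ, Fin.cons_zero, Fin.cons_succ, Finset.sum_const_zero, add_zero]
  exact h.trans (le_mul_of_one_le_left (by positivity) hs)

theorem hasDecay_sum {n k : ℕ} {w : Fin k → F} {f : Fin k → AlgFormula F X} {A : Finset X}
    (h : ∀ i, HasDecay (n + 1) (f i) A) : HasDecay (n + 1) (sum k w f) A := by
  have hle : meanRelRank A (sum k w f).value ≤ ∑ i, meanRelRank A (f i).value := by
    rw [value_sum]
    exact meanRelRank_sum_le _ _ _ _
  rcases Nat.eq_zero_or_pos k with rfl | hk
  · refine hasDecay_of_le_pow (hle.trans ?_)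
    simp only [Finset.univ_eq_empty, Finset.sum_empty]
    positivity
  · choose m hm hmr using h
    -- The summand with the weakest decay supplies a common exponent, and the sizes add up.
    obtain ⟨i₀, -, hi₀⟩ := Finset.exists_min_image Finset.univ (fun i => ∑ l, m i l)
      ⟨(⟨0, hk⟩ : Fin k), Finset.mem_univ _⟩
    refine ⟨m i₀, hm i₀, hle.trans ?_⟩
    calc ∑ i, meanRelRank A (f i).value
        ≤ ∑ i, ((f i).size : ℝ) * (39 / 40) ^ ∑ l, m i₀ l := by
          refine Finset.sum_le_sum fun i hi => (hmr i).trans ?_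
          gcongr ?_ * ?_
          exact pow_le_pow_of_le_one (by norm_num) (by norm_num) (hi₀ i hi)
      _ = ((∑ i, (f i).size : ℕ) : ℝ) * (39 / 40) ^ ∑ l, m i₀ l := by
          rw [← Finset.sum_mul]
          push_cast
          rfl
      _ ≤ _ := by
          gcongr
          simp [size]

/-- The variables of `A` can be distributed among the children of a multilinear product gate so
that each child gets all the variables of `A` that appear in it. -/
theorem exists_meanRelRank_prod_le {k : ℕ} (hk : 0 < k) {f : Fin k → AlgFormula F X}
    (hf : Pairwise fun i j => Disjoint (f i).supp (f j).supp) (A : Finset X) :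
    ∃ κ : X → Fin k, meanRelRank A (prod k f).value ≤
      ∏ j, meanRelRank (A.filter (κ · = j)) (f j).value := by
  classical
  refine ⟨fun x => if h : ∃ j, x ∈ (f j).supp then h.choose else ⟨0, hk⟩, ?_⟩
  rw [value_prod]
  refine meanRelRank_prod_le A _ (fun j => (f j).value) (fun j => (f j).supp)
    (fun j => (f j).value_congr) fun j x hx => ?_
  have h : ∃ j, x ∈ (f j).supp := ⟨j, hx⟩
  rw [dif_pos h]
  by_contra hne
  exact Set.disjoint_left.1 (hf hne) h.choose_spec hx

theorem meanRelRank_prod_zero_le {f : Fin 0 → AlgFormula F X} (A : Finset X) :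
    meanRelRank A (prod 0 f).value ≤ (39 / 40) ^ A.card := by
  refine meanRelRank_le_of_worstRank_le_two fun S => ?_
  rw [value_prod]
  refine (worstRank_prod_le Finset.univ (fun j => (f j).value) S).trans ?_
  simp

theorem hasDecay_prod_of_linear {n k : ℕ} {f : Fin k → AlgFormula F X}
    (hf : Pairwise fun i j => Disjoint (f i).supp (f j).supp)
    (hlin : ∀ j, (f j).IsSigmaPiSigma 0) (A : Finset X) : HasDecay (n + 1) (prod k f) A := by
  classical
  refine hasDecay_of_le_pow ?_
  rcases Nat.eq_zero_or_pos k with rfl | hk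
  · exact meanRelRank_prod_zero_le A
  · obtain ⟨κ, hκ⟩ := exists_meanRelRank_prod_le hk hf A
    refine hκ.trans ?_
    rw [Finset.card_eq_sum_card_fiberwise (f := κ) (t := Finset.univ)
      fun x _ => Finset.mem_coe.2 (Finset.mem_univ _), ← Finset.prod_pow_eq_pow_sum]
    exact Finset.prod_le_prod (fun j _ => meanRelRank_nonneg _ _) fun j _ =>
      meanRelRank_le_of_worstRank_le_two (hlin j).worstRank_le_two

/-- Descend into the child with the largest share of `A`. Each other child with a nonempty share
contributes a factor `6/7 ≤ 39/40`, and the largest share is at least `|A|` over the number of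
nonempty shares. -/
theorem hasDecay_prod {n k : ℕ} {f : Fin k → AlgFormula F X} {A : Finset X} (hA : A.Nonempty)
    (hf : Pairwise fun i j => Disjoint (f i).supp (f j).supp)
    (h : ∀ j (B : Finset X), B.Nonempty → HasDecay (n + 1) (f j) B) :
    HasDecay (n + 2) (prod k f) A := by
  classical
  rcases Nat.eq_zero_or_pos k with rfl | hk
  · exact hasDecay_of_le_pow (meanRelRank_prod_zero_le A)
  obtain ⟨κ, hκ⟩ := exists_meanRelRank_prod_le hk hf A
  set B : Fin k → Finset X := fun j => A.filter (κ · = j) with hB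
  have hcard : A.card = ∑ j, (B j).card :=
    Finset.card_eq_sum_card_fiberwise fun x _ => Finset.mem_coe.2 (Finset.mem_univ (κ x))
  set J : Finset (Fin k) := Finset.univ.filter fun j => (B j).Nonempty with hJ
  obtain ⟨x, hx⟩ := hA
  have hJne : J.Nonempty :=
    ⟨κ x, Finset.mem_filter.2 ⟨Finset.mem_univ _, x, Finset.mem_filter.2 ⟨hx, rfl⟩⟩⟩
  obtain ⟨j₀, hj₀, hmax⟩ := Finset.exists_max_image J (fun j => (B j).card) hJne
  obtain ⟨m, hm, hmr⟩ := h j₀ (B j₀) (Finset.mem_filter.1 hj₀).2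
  have hJcard : (J.erase j₀).card + 1 = J.card := Finset.card_erase_add_one hj₀
  have hAJ : A.card = ∑ j ∈ J, (B j).card := by
    rw [hcard, hJ, Finset.sum_filter_of_ne]
    exact fun j _ hj => Finset.card_ne_zero.1 hj
  refine ⟨Fin.cons (J.erase j₀).card m, ?_, ?_⟩
  · rw [Fin.prod_univ_succ]
    simp only [Fin.cons_zero, Fin.cons_succ, hJcard]
    calc A.card ≤ J.card * (B j₀).card := by
          rw [hAJ, ← smul_eq_mul]
          exact Finset.sum_le_card_nsmul _ _ _ hmax
      _ ≤ _ := Nat.mul_le_mul_left _ hm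
  · have hrest : ∏ j ∈ Finset.univ.erase j₀, meanRelRank (B j) (f j).value ≤
        (39 / 40) ^ (J.erase j₀).card := by
      have hsub : J.erase j₀ ⊆ Finset.univ.erase j₀ :=
        Finset.erase_subset_erase _ (Finset.subset_univ _)
      rw [← Finset.prod_sdiff hsub, ← one_mul ((39 / 40 : ℝ) ^ _)]
      refine mul_le_mul (Finset.prod_le_one (fun j _ => meanRelRank_nonneg _ _)
        fun j _ => meanRelRank_le_one _ _) ?_
        (Finset.prod_nonneg fun j _ => meanRelRank_nonneg _ _) zero_le_one
      rw [← Finset.prod_const]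
      refine Finset.prod_le_prod (fun j _ => meanRelRank_nonneg _ _) fun j hj => ?_
      refine (meanRelRank_le_of_nonempty
        (Finset.mem_filter.1 (Finset.mem_of_mem_erase hj)).2 _).trans (by norm_num)
    rw [Fin.sum_univ_succ]
    simp only [Fin.cons_zero, Fin.cons_succ]
    calc meanRelRank A (prod k f).value ≤ ∏ j, meanRelRank (B j) (f j).value := hκ
      _ = meanRelRank (B j₀) (f j₀).value *
          ∏ j ∈ Finset.univ.erase j₀, meanRelRank (B j) (f j).value :=
          (Finset.mul_prod_erase _ _ (Finset.mem_univ _)).symm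
      _ ≤ ((f j₀).size * (39 / 40) ^ ∑ i, m i) * (39 / 40) ^ (J.erase j₀).card :=
          mul_le_mul hmr hrest (Finset.prod_nonneg fun j _ => meanRelRank_nonneg _ _)
            (by positivity)
      _ = (f j₀).size * (39 / 40) ^ ((J.erase j₀).card + ∑ i, m i) := by
          rw [pow_add]
          ring
      _ ≤ _ := by
          gcongr
          exact size_le_size_prod f j₀

theorem hasDecay_of_isSigmaPiSigma (n : ℕ) : ∀ (Φ : AlgFormula F X), Φ.SyntacticMultilinear →
    Φ.IsSigmaPiSigma (n + 1) → ∀ A : Finset X, A.Nonempty → HasDecay (n + 1) Φ A := by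
  induction n with
  | zero =>
    intro Φ hml hΦ A _
    cases Φ with
    | sum k w f =>
      refine hasDecay_sum fun i => ?_
      obtain ⟨l, g, hg, hlin⟩ := hΦ i
      have hi := hml i
      rw [hg] at hi ⊢
      exact hasDecay_prod_of_linear hi.2 hlin A
    | var => exact hΦ.elim
    | const => exact hΦ.elim
    | prod => exact hΦ.elim
  | succ n ih =>
    intro Φ hml hΦ A hA
    cases Φ with
    | sum k w f =>
      refine hasDecay_sum fun i => ?_
      obtain ⟨l, g, hg, hsub⟩ := hΦ i
      have hi := hml i
      rw [hg] at hi ⊢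
      exact hasDecay_prod hA hi.2 fun j B hB => ih (g j) (hi.1 j) (hsub j) B hB
    | var => exact hΦ.elim
    | const => exact hΦ.elim
    | prod => exact hΦ.elim

end AlgFormula

/-! ### Full rank of `IMM` -/

section fullRank

variable {F : Type*} [Field F]

/-- The tensor power of `!![1, 1; 1, 2]` has full rank. -/
theorem two_pow_le_of_factorRankLE {n m : ℕ}
    (h : FactorRankLE (fun σ τ : Fin n → Bool =>
      ∏ k, (1 + bitValue F (σ k) * bitValue F (τ k))) m) : 2 ^ n ≤ m := by
  -- The factor `!![1, 1; 1, 2]` has determinant `1`, so its inverse `!![2, -1; -1, 1]` exists in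
  -- every characteristic.
  have hinv : (Matrix.of fun σ τ : Fin n → Bool =>
      ∏ k, (1 + bitValue F (σ k) * bitValue F (τ k))) *
      (Matrix.of fun σ τ : Fin n → Bool =>
        ∏ k, (if σ k then (if τ k then (1 : F) else -1) else (if τ k then -1 else 2))) = 1 := by
    ext σ τ
    rw [Matrix.mul_apply]
    simp only [Matrix.of_apply, ← Finset.prod_mul_distrib]
    have := Finset.prod_univ_sum (fun _ : Fin n => (Finset.univ : Finset Bool))
      (fun k b => (1 + bitValue F (σ k) * bitValue F b) *
        (if b then (if τ k then (1 : F) else -1) else (if τ k then -1 else 2)))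
    rw [Fintype.piFinset_univ] at this
    rw [← this, Matrix.one_apply]
    have hk (k : Fin n) : ∑ b : Bool, (1 + bitValue F (σ k) * bitValue F b) *
        (if b then (if τ k then (1 : F) else -1) else (if τ k then -1 else 2)) =
        if σ k = τ k then 1 else 0 := by
      cases σ k <;> cases τ k <;> simp [bitValue] <;> ring
    simp only [hk]
    rw [Finset.prod_ite_zero]
    simp [funext_iff]
  have := FactorRankLE.card_le (N := Matrix.of fun σ τ : Fin n → Bool =>
      ∏ k, (1 + bitValue F (σ k) * bitValue F (τ k))) h hinv
  simpa using this

/-- The live matrices `!![α k, 1; 0, 0]` and `!![β k, 0; 1, 0]` alternate; the other matrices are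
identities. -/
def gadgetMatrix (live : ℕ → Prop) [DecidablePred live] (α β : ℕ → F) (i : ℕ) :
    Matrix (Fin 2) (Fin 2) F :=
  if live i then
    if Even (Nat.count live i) then !![α (Nat.count live i / 2), 1; 0, 0]
    else !![β (Nat.count live i / 2), 0; 1, 0]
  else 1

/-- Two consecutive live matrices multiply to `1 + α k * β k` in the corner and `0` elsewhere; an
unpaired last one leaves the row `(α, 1)`. -/
theorem gadgetMatrix_prod (live : ℕ → Prop) [DecidablePred live] (α β : ℕ → F) (d : ℕ) :
    (List.ofFn fun i : Fin d => gadgetMatrix live α β i).prod 0 0 =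
        (∏ k ∈ Finset.range (Nat.count live d / 2), (1 + α k * β k)) *
          (if Even (Nat.count live d) then 1 else α (Nat.count live d / 2)) ∧
      (List.ofFn fun i : Fin d => gadgetMatrix live α β i).prod 0 1 =
        if Even (Nat.count live d) then 0
        else ∏ k ∈ Finset.range (Nat.count live d / 2), (1 + α k * β k) := by
  induction d with
  | zero => simp
  | succ d ih =>
    rw [List.ofFn_succ', List.concat_eq_append, List.prod_append]
    simp only [List.prod_singleton, Matrix.mul_apply, Fin.sum_univ_two, Fin.val_last,
      Fin.val_castSucc]
    rw [ih.1, ih.2, Nat.count_succ]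
    by_cases hl : live d
    · rcases Nat.even_or_odd' (Nat.count live d) with ⟨k, hk | hk⟩
      · have h1 : (2 * k + 1) / 2 = k := by omega
        simp [gadgetMatrix, hl, hk, h1]
      · have h1 : (2 * k + 1) / 2 = k := by omega
        have h2 : (2 * k + 1 + 1) / 2 = k + 1 := by omega
        simp [gadgetMatrix, hl, hk, h1, h2, Nat.even_add_one, Finset.prod_range_succ]
        ring
    · simp [gadgetMatrix, hl]

theorem eval_IMM (d : ℕ) (p : IMMVar d → F) :
    MvPolynomial.eval p (IMM F d) =
      (List.ofFn fun i => (Matrix.of fun j k => p (i, j, k) : Matrix (Fin 2) (Fin 2) F)).prod 0 0 +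
      (List.ofFn fun i => (Matrix.of fun j k => p (i, j, k) : Matrix (Fin 2) (Fin 2) F)).prod 0 1
      := by
  have h := map_list_prod (RingHom.mapMatrix (m := Fin 2) (MvPolynomial.eval p))
    (List.ofFn (genericMatrix F d))
  rw [List.map_ofFn] at h
  have hM : (⇑(RingHom.mapMatrix (m := Fin 2) (MvPolynomial.eval p)) ∘ genericMatrix F d) =
      fun i => (Matrix.of fun j k => p (i, j, k) : Matrix (Fin 2) (Fin 2) F) := by
    funext i
    ext j k
    simp [genericMatrix]
  rw [hM] at h
  rw [← h, IMM, map_add]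
  rfl

theorem two_pow_le_worstRank_IMM (d : ℕ) {S : Finset (IMMVar d)}
    (hS : S ⊆ Finset.univ.image fun i : Fin d => (i, 0, 0)) :
    2 ^ (S.card / 2) ≤ worstRank (fun p => MvPolynomial.eval p (IMM F d)) S := by
  classical
  set live : ℕ → Prop := fun i => ∃ h : i < d, ((⟨i, h⟩, 0, 0) : IMMVar d) ∈ S with hlive
  have hlive_iff (i : Fin d) : live i ↔ ((i, 0, 0) : IMMVar d) ∈ S := by simp [hlive]
  have hcount : Nat.count live d = S.card := by
    rw [Nat.count_eq_card_filter_range]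
    refine (Finset.card_bij (fun x _ => (x.1 : ℕ)) ?_ ?_ ?_).symm
    · intro x hx
      obtain ⟨i, -, rfl⟩ := Finset.mem_image.1 (hS hx)
      simpa [hlive_iff] using hx
    · intro x hx y hy hxy
      obtain ⟨i, -, rfl⟩ := Finset.mem_image.1 (hS hx)
      obtain ⟨j, -, rfl⟩ := Finset.mem_image.1 (hS hy)
      rw [Fin.ext (a := i) (b := j) hxy]
    · intro i hi
      obtain ⟨-, h, hi⟩ := Finset.mem_filter.1 hi
      exact ⟨_, hi, rfl⟩
  set n := S.card / 2 with hn
  -- The default `false` gives an unpaired last live entry the value `0`, so for odd `|S|` the first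
  -- row still sums to the product.
  set bits : (Fin n → Bool) → ℕ → Bool := fun σ k => if h : k < n then σ ⟨k, h⟩ else false
  set point : (Fin n → Bool) → IMMVar d → Bool :=
    fun σ x => bits σ (Nat.count live x.1 / 2)
  -- Live entries alternate between rows and columns, so each pair contributes one row bit and one
  -- column bit. The base point carries the fixed gadget entries.
  have h := (worstRank_spec (fun p => MvPolynomial.eval p (IMM F d)) S
    (S.filter fun x => Even (Nat.count live x.1))
    (fun x => gadgetMatrix live 0 0 x.1 x.2.1 x.2.2)).comp point point
  refine two_pow_le_of_factorRankLE (F := F) ?_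
  convert h using 3 with σ τ
  have hM : (fun i : Fin d => (Matrix.of fun j k => splitPoint
      (S.filter fun x => Even (Nat.count live x.1)) S
      (fun x => gadgetMatrix live 0 0 x.1 x.2.1 x.2.2) (point σ) (point τ) (i, j, k) :
        Matrix (Fin 2) (Fin 2) F)) =
      fun i : Fin d => gadgetMatrix live (fun k => bitValue F (bits σ k))
        (fun k => bitValue F (bits τ k)) i := by
    funext i
    have hoff (j k : Fin 2) (hjk : ¬ (j = 0 ∧ k = 0)) : ((i, j, k) : IMMVar d) ∉ S := by
      intro hx
      obtain ⟨i', -, hi'⟩ := Finset.mem_image.1 (hS hx)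
      simp only [Prod.mk.injEq] at hi'
      exact hjk ⟨hi'.2.1.symm, hi'.2.2.symm⟩
    have h01 := hoff 0 1 (by simp)
    have h10 := hoff 1 0 (by simp)
    have h11 := hoff 1 1 (by simp)
    by_cases hi : ((i, 0, 0) : IMMVar d) ∈ S <;>
    by_cases he : Even (Nat.count live i) <;>
    · have hl := hlive_iff i
      ext j k
      fin_cases j <;> fin_cases k <;>
        simp [splitPoint, gadgetMatrix, hl, hi, he, h01, h10, h11, point]
  rw [eval_IMM, hM, (gadgetMatrix_prod live _ _ d).1, (gadgetMatrix_prod live _ _ d).2, hcount,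
    ← hn]
  have hprod : ∏ k ∈ Finset.range n, (1 + bitValue F (bits σ k) * bitValue F (bits τ k)) =
      ∏ k : Fin n, (1 + bitValue F (σ k) * bitValue F (τ k)) := by
    rw [← Fin.prod_univ_eq_prod_range
      (fun k => 1 + bitValue F (bits σ k) * bitValue F (bits τ k))]
    exact Finset.prod_congr rfl fun k _ => by simp [bits]
  rw [hprod]
  by_cases he : Even S.card
  · simp [he]
  · simp [he, bits, bitValue]

end fullRank

/-! ### From decay to the size bound -/

theorem mul_rpow_le_sum {n d : ℕ} (hn : 0 < n) (m : Fin n → ℕ) (h : d ≤ ∏ i, (m i + 1)) :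
    (n : ℝ) * (d : ℝ) ^ (1 / (n : ℝ)) ≤ ∑ i, ((m i : ℝ) + 1) := by
  have hn' : (0 : ℝ) < n := by exact_mod_cast hn
  have hamgm := Real.geom_mean_le_arith_mean (Finset.univ : Finset (Fin n)) (fun _ => 1)
    (fun i => (m i : ℝ) + 1) (fun _ _ => zero_le_one) (by simpa using hn')
    (fun i _ => by positivity)
  simp only [Real.rpow_one, one_mul, Finset.sum_const, Finset.card_univ, Fintype.card_fin,
    nsmul_eq_mul, mul_one] at hamgm
  have hd : (d : ℝ) ≤ ∏ i, ((m i : ℝ) + 1) := by exact_mod_cast h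
  have h1 : (d : ℝ) ^ (1 / (n : ℝ)) ≤ (∏ i, ((m i : ℝ) + 1)) ^ (n : ℝ)⁻¹ := by
    rw [one_div]
    exact Real.rpow_le_rpow (by positivity) hd (by positivity)
  have h2 := h1.trans hamgm
  rw [le_div_iff₀ hn'] at h2
  linarith

theorem theorem3p1 :
    ∃ c : ℝ, 0 < c ∧
      ∀ (F : Type*) [Field F] (d Δ : ℕ), 1 ≤ d → 1 ≤ Δ → (Δ : ℝ) ≤ Real.logb 2 (d : ℝ) →
        ∀ Φ : AlgFormula F (IMMVar d),
          Φ.SyntacticMultilinear → Φ.IsSigmaPiSigma Δ → Φ.eval = IMM F d →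
            (2 : ℝ) ^ (c * ((Δ : ℝ) * (d : ℝ) ^ (1 / (Δ : ℝ)))) ≤ (Φ.size : ℝ) := by
  have hlog : 0 < Real.logb 2 (40 / 39) := Real.logb_pos (by norm_num) (by norm_num)
  -- One factor `2` of the `4` pays for passing from `∑ (m i + 1)` to `∑ m i`, the other for the
  -- final squaring.
  refine ⟨Real.logb 2 (40 / 39) / 4, by positivity, ?_⟩
  intro F _ d Δ hd hΔ hΔd Φ hml hΦ heval
  classical
  have hd0 : (0 : ℝ) < d := by exact_mod_cast hd
  have hΔ0 : (0 : ℝ) < Δ := by exact_mod_cast hΔ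
  have hvalue : Φ.value = fun p => MvPolynomial.eval p (IMM F d) := by
    funext p
    rw [AlgFormula.value, heval]
  set A : Finset (IMMVar d) := Finset.univ.image fun i : Fin d => (i, 0, 0) with hA
  have hAcard : A.card = d := by
    rw [hA, Finset.card_image_of_injective _ fun i j h => (Prod.mk.inj h).1]
    simp
  have hrank : ∀ S ⊆ A, 2 ^ (S.card / 2) ≤ worstRank Φ.value S := fun S hS => by
    rw [hvalue]
    exact two_pow_le_worstRank_IMM d hS
  -- Size at least `2` gives `2 * size ≤ size ^ 2`, absorbing the `1/2` in the lower bound on the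
  -- mean. An empty sum is excluded because its rank is `0`.
  have hsize : (2 : ℝ) ≤ Φ.size := by
    obtain ⟨Δ, rfl⟩ := Nat.exists_eq_add_of_le' hΔ
    cases Φ with
    | sum k w f =>
      rcases Nat.eq_zero_or_pos k with rfl | hk
      · have h1 := hrank ∅ (Finset.empty_subset _)
        have h2 := worstRank_sum_le Finset.univ w (fun i => (f i).value) ∅
        rw [AlgFormula.value_sum] at h1
        simp at h1 h2
        omega
      · have h1 := Finset.single_le_sum (f := fun i => (f i).size) (fun _ _ => Nat.zero_le _)
          (Finset.mem_univ (⟨0, hk⟩ : Fin k))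
        have h2 := (f ⟨0, hk⟩).one_le_size
        have h3 : 2 ≤ (AlgFormula.sum k w f).size := by
          simp only [AlgFormula.size] at h1 ⊢
          omega
        exact_mod_cast h3
    | var => exact hΦ.elim
    | const => exact hΦ.elim
    | prod => exact hΦ.elim
  obtain ⟨m, hm, hmr⟩ : AlgFormula.HasDecay Δ Φ A := by
    obtain ⟨Δ, rfl⟩ := Nat.exists_eq_add_of_le' hΔ
    exact AlgFormula.hasDecay_of_isSigmaPiSigma Δ Φ hml hΦ A
      (Finset.card_pos.1 (by omega))
  rw [hAcard] at hm
  set s : ℕ := ∑ i, m i with hs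
  have hX : (40 / 39 : ℝ) ^ s ≤ 2 * Φ.size := by
    have h1 := (le_meanRelRank hrank).trans hmr
    have h2 : (39 / 40 : ℝ) ^ s * (40 / 39) ^ s = 1 := by
      rw [← mul_pow]
      norm_num
    have h3 : (0 : ℝ) < (40 / 39) ^ s := by positivity
    have h4 := mul_le_mul_of_nonneg_right h1 h3.le
    rw [mul_assoc, h2] at h4
    linarith
  -- Here `Δ ≤ log₂ d` enters: it makes the `Δ` extra ones in `∑ (m i + 1)` at most half of `Δ d ^
  -- (1 / Δ)`.
  have hroot : 2 ≤ (d : ℝ) ^ (1 / (Δ : ℝ)) := by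
    have h1 : (2 : ℝ) ^ (Δ : ℝ) ≤ d := (Real.le_logb_iff_rpow_le (by norm_num) hd0).1 hΔd
    have h2 := Real.rpow_le_rpow (by positivity) h1 (by positivity : 0 ≤ 1 / (Δ : ℝ))
    rwa [← Real.rpow_mul (by norm_num), mul_one_div_cancel hΔ0.ne', Real.rpow_one] at h2
  have hsum : (Δ : ℝ) * (d : ℝ) ^ (1 / (Δ : ℝ)) ≤ 2 * s := by
    have h1 := mul_rpow_le_sum hΔ m hm
    have h2 : ∑ i, ((m i : ℝ) + 1) = s + Δ := by
      simp [Finset.sum_add_distrib, hs]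
    have h3 := mul_le_mul_of_nonneg_left hroot hΔ0.le
    linarith
  have hpow : ((2 : ℝ) ^ (Real.logb 2 (40 / 39) / 4 * ((Δ : ℝ) * (d : ℝ) ^ (1 / (Δ : ℝ))))) ^ 2
      ≤ (40 / 39) ^ s := by
    have hb : (40 / 39 : ℝ) ^ s = 2 ^ (Real.logb 2 (40 / 39) * s) := by
      rw [Real.rpow_mul (by norm_num), Real.rpow_logb (by norm_num) (by norm_num) (by norm_num),
        Real.rpow_natCast]
    rw [hb, ← Real.rpow_natCast _ 2, ← Real.rpow_mul (by norm_num)]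
    refine Real.rpow_le_rpow_of_exponent_le (by norm_num) ?_
    have := mul_le_mul_of_nonneg_left hsum hlog.le
    push_cast
    linarith
  refine le_of_sq_le_sq ?_ (by positivity)
  nlinarith
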